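/- Let $k\ge 0$ be a fixed integer and $[n]=\{1,\dots,n\}$. A *Ucycle packing* for the $k$-subsets of $[n]$ is a (possibly empty) cyclic sequence of elements of $[n]$ in which every block of $k$ cyclically consecutive entries consists of $k$ distinct symbols, i.e. forms a $k$-subset of $[n]$, and in which every $k$-subset of $[n]$ appears at most once in this way (each starting position in the cyclic sequence counts as one appearance). Then there is a family $\{S_n\}_{n\ge 0}$, where $S_n$ is a Ucycle packing for the $k$-subsets of $[n]$, such that the length of $S_n$ is $(1-o(1))\binom nk$ as $n\to\infty$. In particular, the number of $k$-subsets of $[n]$ that appear in $S_n$, divided by $\binom nk$, tends to $1$ as $n\to\infty$. -/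

import Mathlib

open Filter Topology

/-- For a cyclic sequence `s` of length `L` over the alphabet `[n]` (modelled by `Fin n`), the set
of symbols occurring in the block of `k` cyclically consecutive entries that starts at
position `i`, that is `{s i, s (i + 1), …, s (i + k - 1)}` with positions read modulo `L`. -/
def windowSet {n L : ℕ} (k : ℕ) (s : Fin L → Fin n) (i : Fin L) : Finset (Fin n) :=
  Finset.univ.image fun j : Fin k =>
    s ⟨((i : ℕ) + (j : ℕ)) % L, Nat.mod_lt _ (Nat.pos_of_ne_zero fun h => by
      have := i.isLt; omega)⟩

/-- The `k`-subset `A` appears contiguously in `s` at position `i`: the `k` consecutive entries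
starting at `i` are the `k` elements of `A`, each once, in some order. -/
def AppearsAt {n L : ℕ} (k : ℕ) (s : Fin L → Fin n) (A : Finset (Fin n)) (i : Fin L) : Prop :=
  A.card = k ∧ windowSet k s i = A

/-- The cyclic sequence `s` is a Ucycle packing for the `k`-subsets of `[n]`: every block of `k`
consecutive entries is a `k`-subset of `[n]`, and every `k`-subset appears at most once. -/
def IsUcyclePacking {n L : ℕ} (k : ℕ) (s : Fin L → Fin n) : Prop :=
  (∀ i : Fin L, ∃ A : Finset (Fin n), AppearsAt k s A i) ∧
  ∀ A : Finset (Fin n), ∀ i j : Fin L, AppearsAt k s A i → AppearsAt k s A j → i = j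

/-- The `k`-subsets of `[n]` that are covered by (appear somewhere in) `s`. -/
def coveredSubsets {n L : ℕ} (k : ℕ) (s : Fin L → Fin n) : Set (Finset (Fin n)) :=
  {A | ∃ i : Fin L, AppearsAt k s A i}

/-- A near-Ucycle: a family of Ucycle packings `S n` for the `k`-subsets of `[n]`, one for each
`n`, where the length `L n` of `S n` is `(1 - o(1)) * (n choose k)`. -/
def IsNearUcycle (k : ℕ) (L : ℕ → ℕ) (S : ∀ n : ℕ, Fin (L n) → Fin n) : Prop :=
  (∀ n : ℕ, IsUcyclePacking k (S n)) ∧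
  ∃ ε : ℕ → ℝ, Tendsto ε atTop (𝓝 0) ∧ ∀ n : ℕ, (L n : ℝ) = (1 - ε n) * (n.choose k : ℝ)

/-! Split most of `[n]` into `M` parts, each a copy of `ZMod k × ZMod p` with `p` prime. For `M`
large but bounded and `p → ∞`, almost all `k`-sets have at most one symbol in each part. For each
`k`-set of parts and each `s : ZMod k → ZMod k`, one word runs cyclically through these parts
(`partWord`). Its `ZMod p` coordinates form a linear recurring sequence of period `p ^ k - 1`; its
`ZMod k` coordinates repeat with period `k` up to a drift of one. By the drift, the residue sum of
an unordered block reveals which part comes first (`sum_residueSeq`), so the block determines its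
order, then its position and word (`partWord_window_inj`). This yields `M.choose k * k ^ k * (p ^ k
- 1)` blocks, nearly all of the `M.choose k * (k * p) ^ k` transversal `k`-sets. The number of words
depends only on `M` and `k`, so separating them by fresh letters uses up boundedly many symbols
(`joinWords_blockSet_inj`). -/

/-- The set of symbols in the block of `k` consecutive entries of `g` that starts at `i`. -/
def blockSet {α : Type*} [DecidableEq α] (k : ℕ) (g : ℕ → α) (i : ℕ) : Finset α :=
  (Finset.range k).image fun j => g (i + j)

lemma mem_blockSet {α : Type*} [DecidableEq α] {k : ℕ} {g : ℕ → α} {i : ℕ} {a : α} :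
    a ∈ blockSet k g i ↔ ∃ j < k, g (i + j) = a := by
  simp [blockSet]

lemma exists_packing_of_periodic {α : Type*} [Fintype α] [DecidableEq α] {k L n : ℕ}
    (hn : Fintype.card α ≤ n) (g : ℕ → α) (hper : Function.Periodic g L)
    (hne : ∀ i d, 0 < d → d < k → g i ≠ g (i + d))
    (hset : ∀ i < L, ∀ i' < L, blockSet k g i = blockSet k g i' → i = i') :
    ∃ s : Fin L → Fin n, IsUcyclePacking k s := by
  obtain ⟨e⟩ : Nonempty (α ↪ Fin n) :=
    Function.Embedding.nonempty_of_card_le (by simpa using hn)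
  have hw : ∀ i : Fin L, windowSet k (fun i : Fin L => e (g i)) i
      = (blockSet k g i).map e := by
    intro i
    ext a
    simp only [windowSet, Finset.mem_image, Finset.mem_univ, true_and, Finset.mem_map,
      mem_blockSet]
    constructor
    · rintro ⟨j, rfl⟩
      exact ⟨_, ⟨j, j.2, rfl⟩, by simp only [hper.map_mod_nat]⟩
    · rintro ⟨_, ⟨j, hj, rfl⟩, rfl⟩
      exact ⟨⟨j, hj⟩, by simp only [hper.map_mod_nat]⟩
  refine ⟨fun i => e (g i), fun i => ⟨_, ?_, rfl⟩, ?_⟩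
  · rw [hw, Finset.card_map, blockSet, Finset.card_image_of_injOn, Finset.card_range]
    intro j hj j' hj' h
    simp only [Finset.coe_range, Set.mem_Iio] at hj hj'
    rcases lt_trichotomy j j' with hlt | rfl | hlt
    · exact absurd (by simpa [add_assoc, Nat.add_sub_cancel' hlt.le] using h)
        (hne (i + j) (j' - j) (by omega) (by omega))
    · rfl
    · exact absurd (by simpa [add_assoc, Nat.add_sub_cancel' hlt.le] using h.symm)
        (hne (i + j') (j - j') (by omega) (by omega))
  · rintro A i j ⟨-, hi⟩ ⟨-, hj⟩
    rw [hw] at hi hj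
    exact Fin.ext (hset _ i.2 _ j.2 (Finset.map_injective e (hi.trans hj.symm)))

/-! ### Joining words by fresh letters -/

/-- Finitely many words, written one after another and separated by `k` fresh letters each;
of each word, `N + k - 1` letters are used. -/
def joinWords {β : Type*} {m : ℕ} [NeZero m] (k N : ℕ) (u : Fin m → ℕ → β) (i : ℕ) :
    β ⊕ (Fin m × ℕ) :=
  if i % (N + 2 * k - 1) < N + k - 1 then
    Sum.inl (u (Fin.ofNat m (i / (N + 2 * k - 1))) (i % (N + 2 * k - 1)))
  else
    Sum.inr (Fin.ofNat m (i / (N + 2 * k - 1)), i % (N + 2 * k - 1) - (N + k - 1))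

section Join

variable {β : Type*} {m : ℕ} [NeZero m] {k N : ℕ} {u : Fin m → ℕ → β}

lemma joinWords_inl (w o : ℕ) (h : o < N + k - 1) :
    joinWords k N u ((N + 2 * k - 1) * w + o) = Sum.inl (u (Fin.ofNat m w) o) := by
  have hD : o < N + 2 * k - 1 := by omega
  have h1 : ((N + 2 * k - 1) * w + o) / (N + 2 * k - 1) = w := by
    rw [Nat.mul_add_div (by omega), Nat.div_eq_of_lt hD, add_zero]
  have h2 : ((N + 2 * k - 1) * w + o) % (N + 2 * k - 1) = o := by
    rw [Nat.mul_add_mod, Nat.mod_eq_of_lt hD]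
  rw [joinWords, h1, h2, if_pos h]

lemma joinWords_inr (w o : ℕ) (h : N + k - 1 ≤ o) (hD : o < N + 2 * k - 1) :
    joinWords k N u ((N + 2 * k - 1) * w + o)
      = Sum.inr (Fin.ofNat m w, o - (N + k - 1)) := by
  have h1 : ((N + 2 * k - 1) * w + o) / (N + 2 * k - 1) = w := by
    rw [Nat.mul_add_div (by omega), Nat.div_eq_of_lt hD, add_zero]
  have h2 : ((N + 2 * k - 1) * w + o) % (N + 2 * k - 1) = o := by
    rw [Nat.mul_add_mod, Nat.mod_eq_of_lt hD]
  rw [joinWords, h1, h2, if_neg (by omega)]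

lemma exists_block_offset (k N : ℕ) (hk : 0 < k) (i : ℕ) :
    ∃ w o, i = (N + 2 * k - 1) * w + o ∧ o < N + 2 * k - 1 :=
  ⟨i / (N + 2 * k - 1), i % (N + 2 * k - 1), (Nat.div_add_mod _ _).symm,
    Nat.mod_lt _ (by omega)⟩

lemma joinWords_periodic (hk : 0 < k) :
    Function.Periodic (joinWords k N u) ((N + 2 * k - 1) * m) := by
  intro i
  obtain ⟨w, o, rfl, ho⟩ := exists_block_offset k N hk i
  have hw : Fin.ofNat m (w + m) = Fin.ofNat m w := by
    ext; simp
  have : (N + 2 * k - 1) * w + o + (N + 2 * k - 1) * m = (N + 2 * k - 1) * (w + m) + o := by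
    ring
  rw [this]
  rcases lt_or_ge o (N + k - 1) with h | h
  · rw [joinWords_inl _ _ h, joinWords_inl _ _ h, hw]
  · rw [joinWords_inr _ _ h ho, joinWords_inr _ _ h ho, hw]

lemma joinWords_ne (hN : 0 < N) (hu : ∀ w o d, 0 < d → d < k → u w o ≠ u w (o + d))
    (i d : ℕ) (hd : 0 < d) (hdk : d < k) :
    joinWords k N u i ≠ joinWords k N u (i + d) := by
  obtain ⟨w, o, rfl, ho⟩ := exists_block_offset k N (by omega) i
  rcases lt_or_ge (o + d) (N + 2 * k - 1) with h | h
  · rw [add_assoc]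
    rcases lt_or_ge o (N + k - 1) with h1 | h1
    · rw [joinWords_inl _ _ h1]
      rcases lt_or_ge (o + d) (N + k - 1) with h2 | h2
      · rw [joinWords_inl _ _ h2]
        simpa using hu _ _ _ hd hdk
      · rw [joinWords_inr _ _ h2 h]
        simp
    · rw [joinWords_inr _ _ h1 ho, joinWords_inr _ _ (by omega) h]
      simp only [ne_eq, Sum.inr.injEq, Prod.mk.injEq, true_and]
      omega
  · have : (N + 2 * k - 1) * w + o + d
        = (N + 2 * k - 1) * (w + 1) + (o + d - (N + 2 * k - 1)) := by
      rw [mul_add, mul_one]; omega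
    rw [this, joinWords_inr _ _ (by omega) ho, joinWords_inl _ _ (by omega)]
    simp

lemma inr_mem_blockSet_joinWords [DecidableEq β] (hN : 0 < N) (hk : 0 < k) (w o : ℕ)
    (ho : o < N + 2 * k - 1) (v : Fin m) (c : ℕ) (hc : c < k) :
    Sum.inr (v, c) ∈ blockSet k (joinWords k N u) ((N + 2 * k - 1) * w + o) ↔
      v = Fin.ofNat m w ∧ o ≤ N + k - 1 + c ∧ N + k - 1 + c < o + k := by
  rw [mem_blockSet]
  constructor
  · rintro ⟨j, hj, h⟩
    rcases lt_or_ge (o + j) (N + 2 * k - 1) with hD | hD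
    · rw [add_assoc] at h
      rcases lt_or_ge (o + j) (N + k - 1) with h2 | h2
      · rw [joinWords_inl _ _ h2] at h
        simp at h
      · rw [joinWords_inr _ _ h2 hD] at h
        simp only [Sum.inr.injEq, Prod.mk.injEq] at h
        exact ⟨h.1.symm, by omega, by omega⟩
    · have : (N + 2 * k - 1) * w + o + j
          = (N + 2 * k - 1) * (w + 1) + (o + j - (N + 2 * k - 1)) := by
        rw [mul_add, mul_one]; omega
      rw [this, joinWords_inl _ _ (by omega)] at h
      simp at h
  · rintro ⟨rfl, h1, h2⟩
    refine ⟨N + k - 1 + c - o, by omega, ?_⟩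
    rw [add_assoc, joinWords_inr _ _ (by omega) (by omega)]
    congr 2
    omega

lemma blockSet_joinWords [DecidableEq β] (w o : ℕ) (ho : o < N) :
    blockSet k (joinWords k N u) ((N + 2 * k - 1) * w + o)
      = (blockSet k (u (Fin.ofNat m w)) o).map Function.Embedding.inl := by
  rw [blockSet, blockSet, Finset.map_eq_image, Finset.image_image]
  refine Finset.image_congr fun j hj => ?_
  simp only [Finset.coe_range, Set.mem_Iio] at hj
  rw [add_assoc, joinWords_inl _ _ (by omega)]
  rfl

/-- A block that leaves its word is identified by its fresh letters alone: they form an initial or a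
final segment of the separator. With only `k - 1` of them, the blocks starting at the first fresh
letter and just before it would contain the same ones. -/
lemma joinWords_blockSet_inj [DecidableEq β] (hN : 0 < N) (hk : 0 < k)
    (hset : ∀ w w' : Fin m, ∀ o < N, ∀ o' < N,
      blockSet k (u w) o = blockSet k (u w') o' → w = w' ∧ o = o')
    (i : ℕ) (hi : i < (N + 2 * k - 1) * m) (i' : ℕ) (hi' : i' < (N + 2 * k - 1) * m)
    (h : blockSet k (joinWords k N u) i = blockSet k (joinWords k N u) i') : i = i' := by
  obtain ⟨w, o, rfl, ho⟩ := exists_block_offset k N hk i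
  obtain ⟨w', o', rfl, ho'⟩ := exists_block_offset k N hk i'
  have hwm : w < m := lt_of_mul_lt_mul_left (lt_of_le_of_lt (Nat.le_add_right _ _) hi) (Nat.zero_le _)
  have hwm' : w' < m :=
    lt_of_mul_lt_mul_left (lt_of_le_of_lt (Nat.le_add_right _ _) hi') (Nat.zero_le _)
  have hmem : ∀ v c, c < k → ((v = Fin.ofNat m w ∧ o ≤ N + k - 1 + c ∧ N + k - 1 + c < o + k) ↔
      (v = Fin.ofNat m w' ∧ o' ≤ N + k - 1 + c ∧ N + k - 1 + c < o' + k)) := by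
    intro v c hc
    rw [← inr_mem_blockSet_joinWords (u := u) hN hk w o ho v c hc, h,
      inr_mem_blockSet_joinWords hN hk w' o' ho' v c hc]
  have hofNat : Fin.ofNat m w = Fin.ofNat m w' → w = w' := by
    intro e
    simpa [Nat.mod_eq_of_lt hwm, Nat.mod_eq_of_lt hwm'] using congrArg Fin.val e
  suffices w = w' ∧ o = o' by rw [this.1, this.2]
  rcases lt_or_ge o N with hoN | hoN
  · have hoN' : o' < N := by
      by_contra hcon
      -- By truncated subtraction this is the first fresh letter in the block: letter `0` if the
      -- block starts inside the word.
      have h1 := hmem (Fin.ofNat m w') (o' - (N + k - 1)) (by omega)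
      have h2 := h1.2 ⟨rfl, by omega, by omega⟩
      omega
    rw [blockSet_joinWords _ _ hoN, blockSet_joinWords _ _ hoN'] at h
    obtain ⟨h1, h2⟩ := hset _ _ _ hoN _ hoN' (Finset.map_injective _ h)
    exact ⟨hofNat h1, h2⟩
  · have h1 := (hmem (Fin.ofNat m w) (o - (N + k - 1)) (by omega)).1 ⟨rfl, by omega, by omega⟩
    refine ⟨hofNat h1.1, ?_⟩
    rw [h1.1] at hmem
    have h2 := hmem (Fin.ofNat m w')
    simp only [true_and] at h2
    by_contra hne
    rcases lt_or_gt_of_ne hne with hlt | hlt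
    · rcases lt_or_ge o (N + k - 1) with h3 | h3
      -- The first fresh letter just past the end of the earlier block.
      · have := h2 (min (o + 1 - N) (k - 1)) (by omega)
        omega
      · have := h2 (o - (N + k - 1)) (by omega)
        omega
    · rcases lt_or_ge o' (N + k - 1) with h3 | h3
      · have := h2 (min (o' + 1 - N) (k - 1)) (by omega)
        omega
      · have := h2 (o' - (N + k - 1)) (by omega)
        omega

end Join

lemma exists_packing_of_words {β : Type*} [Fintype β] {m k N n : ℕ}
    (hk : 0 < k) (hN : 0 < N) (hn : Fintype.card β + m * k ≤ n) (u : Fin m → ℕ → β)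
    (hu : ∀ w o d, 0 < d → d < k → u w o ≠ u w (o + d))
    (hset : ∀ w w' : Fin m, ∀ o < N, ∀ o' < N, (∀ b, (∃ j < k, u w (o + j) = b) ↔
      ∃ j < k, u w' (o' + j) = b) → w = w' ∧ o = o') :
    ∃ L, ∃ s : Fin L → Fin n, IsUcyclePacking k s ∧ m * N ≤ L := by
  classical
  rcases Nat.eq_zero_or_pos m with rfl | hm
  · exact ⟨0, Fin.elim0, ⟨fun i => i.elim0, fun _ i => i.elim0⟩, by simp⟩
  have : NeZero m := ⟨hm.ne'⟩
  have hset' : ∀ w w' : Fin m, ∀ o < N, ∀ o' < N,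
      blockSet k (u w) o = blockSet k (u w') o' → w = w' ∧ o = o' := fun w w' o ho o' ho' h =>
    hset w w' o ho o' ho' fun b => by rw [← mem_blockSet, h, mem_blockSet]
  have hlt : ∀ i, i % (N + 2 * k - 1) - (N + k - 1) < k := fun i => by
    have := Nat.mod_lt i (show 0 < N + 2 * k - 1 by omega)
    omega
  let emb : β ⊕ (Fin m × Fin k) → β ⊕ (Fin m × ℕ) := Sum.map id (Prod.map id Fin.val)
  have hemb : Function.Injective emb :=
    Sum.map_injective.2 ⟨Function.injective_id, Function.injective_id.prodMap Fin.val_injective⟩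
  have hex : ∀ i, ∃ a, emb a = joinWords k N u i := fun i => by
    unfold joinWords
    split_ifs
    · exact ⟨Sum.inl _, rfl⟩
    · exact ⟨Sum.inr (_, ⟨_, hlt i⟩), rfl⟩
  choose g hg using hex
  have hblock : ∀ i, (blockSet k g i).image emb = blockSet k (joinWords k N u) i := by
    intro i
    simp only [blockSet, Finset.image_image, Function.comp_def, hg]
  obtain ⟨s, hs⟩ := exists_packing_of_periodic (k := k) (L := (N + 2 * k - 1) * m) (n := n)
    (by simpa using hn) g
    (fun i => hemb (by rw [hg, hg, joinWords_periodic hk i]))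
    (fun i d hd hdk h => joinWords_ne hN hu i d hd hdk (by rw [← hg, ← hg, h]))
    (fun i hi i' hi' h => joinWords_blockSet_inj hN hk hset' i hi i' hi'
      (by rw [← hblock, ← hblock, h]))
  exact ⟨_, s, hs, by rw [mul_comm]; exact Nat.mul_le_mul_right _ (by omega)⟩

/-! ### Maximal-period sequences from a finite field -/

/-- A linear recurring sequence over `ZMod p` of maximal period. -/
lemma exists_seq_windows_injective (p k : ℕ) [hp : Fact p.Prime] (hk : 0 < k) :
    ∃ x : ℕ → ZMod p, ∀ i < p ^ k - 1, ∀ i' < p ^ k - 1,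
      (∀ j < k, x (i + j) = x (i' + j)) → i = i' := by
  let K := GaloisField p k
  have : Fintype K := Fintype.ofFinite K
  have hcard : Nat.card K = p ^ k := GaloisField.card p k hk.ne'
  obtain ⟨α, hα⟩ := IsCyclic.exists_generator (α := Kˣ)
  have hord : orderOf α = p ^ k - 1 := by
    rw [orderOf_eq_card_of_forall_mem_zpowers hα, Nat.card_units, hcard]
  obtain ⟨φ, hφ⟩ : ∃ φ : Module.Dual (ZMod p) K, φ 1 ≠ 0 := by
    by_contra! h
    exact one_ne_zero ((Module.forall_dual_apply_eq_zero_iff (ZMod p) (1 : K)).1 h)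
  refine ⟨fun i => φ ((α : K) ^ i), fun i hi i' hi' h => ?_⟩
  rw [← hord] at hi hi'
  refine pow_injOn_Iio_orderOf hi hi' (Units.ext ?_)
  by_contra hne
  push_cast at hne
  set b : K := (α : K) ^ i - (α : K) ^ i' with hb
  have hb0 : b ≠ 0 := sub_ne_zero.2 hne
  have h0 : ∀ j < k, φ (b * (α : K) ^ j) = 0 := by
    intro j hj
    rw [hb, sub_mul, ← pow_add, ← pow_add, map_sub, sub_eq_zero]
    exact h j hj
  have hint : IsIntegral (ZMod p) (α : K) := IsIntegral.of_finite _ _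
  have hdeg : (minpoly (ZMod p) (α : K)).natDegree ≤ k := by
    have := minpoly.natDegree_le (A := ZMod p) (α : K)
    rwa [GaloisField.finrank p hk.ne'] at this
  -- The minimal polynomial of `α` has degree at most `k`, so the powers below `k` span all powers.
  have hall : ∀ j, φ (b * (α : K) ^ j) = 0 := by
    intro j
    set P := (Polynomial.X ^ j : Polynomial (ZMod p)) %ₘ minpoly (ZMod p) (α : K) with hP
    have hPdeg : P.natDegree < k :=
      (Polynomial.natDegree_modByMonic_lt _ (minpoly.monic hint)
        (minpoly.ne_one (ZMod p) (α : K))).trans_le hdeg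
    have hev : Polynomial.aeval (α : K) P = (α : K) ^ j := by
      have := Polynomial.aeval_modByMonic_eq_self_of_root (p := Polynomial.X ^ j)
        (minpoly.aeval (ZMod p) (α : K))
      rw [hP, this]
      simp
    rw [← hev, Polynomial.aeval_eq_sum_range' hPdeg, Finset.mul_sum, map_sum]
    refine Finset.sum_eq_zero fun j hj => ?_
    rw [mul_smul_comm, map_smul, h0 j (Finset.mem_range.1 hj), smul_zero]
  -- Since `α` generates the units, `b⁻¹` is among its powers, which forces `φ 1 = 0`.
  obtain ⟨j, hj⟩ := (mem_powers_iff_mem_zpowers).2 (hα (Units.mk0 b hb0)⁻¹)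
  have hj' : (α : K) ^ j = b⁻¹ := by
    have := congrArg Units.val hj
    simpa using this
  have := hall j
  rw [hj', mul_inv_cancel₀ hb0] at this
  exact hφ this

/-! ### Words whose unordered blocks determine their order -/

/-- A sequence of residues modulo `k` that increases by one over each period of length `k`,
with prescribed initial values. -/
def residueSeq {k : ℕ} (s : ZMod k → ZMod k) (t : ℕ) : ZMod k :=
  s (t : ZMod k) + ((t / k : ℕ) : ZMod k)

/-- Sliding the block by one replaces the entry at `t` by the one at `t + k`, which is larger by
one. -/
lemma sum_residueSeq {k : ℕ} [NeZero k] (s : ZMod k → ZMod k) (hs : ∑ c, s c = 0) (t : ℕ) :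
    ∑ j ∈ Finset.range k, residueSeq s (t + j) = (t : ZMod k) := by
  induction t with
  | zero =>
    rw [Nat.cast_zero, ← hs]
    refine Finset.sum_nbij' (fun j => (j : ZMod k)) ZMod.val (by simp) ?_ ?_ (by simp) ?_
    · intro c _; simpa using ZMod.val_lt c
    · intro j hj; exact ZMod.val_cast_of_lt (by simpa using hj)
    · intro j hj
      have : j / k = 0 := Nat.div_eq_of_lt (by simpa using hj)
      simp [residueSeq, this]
  | succ t ih =>
    have h1 := Finset.sum_range_succ (fun j => residueSeq s (t + j)) k
    have h2 := Finset.sum_range_succ' (fun j => residueSeq s (t + j)) k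
    have h3 : residueSeq s (t + k) = residueSeq s t + 1 := by
      simp [residueSeq, Nat.add_div_right _ (NeZero.pos k), add_assoc]
    simp only [add_zero] at h2
    rw [h1, ih, h3] at h2
    push_cast
    have h4 : ∑ j ∈ Finset.range k, residueSeq s (t + 1 + j)
        = ∑ j ∈ Finset.range k, residueSeq s (t + (j + 1)) :=
      Finset.sum_congr rfl fun j _ => by rw [add_assoc, add_comm 1 j]
    rw [h4]
    linear_combination -h2

/-- The translate of `s` along the coordinate `0` whose values sum to zero. -/
def zeroSum {k : ℕ} [NeZero k] (s : ZMod k → ZMod k) : ZMod k → ZMod k :=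
  s - Pi.single 0 (∑ c, s c)

lemma sum_zeroSum {k : ℕ} [NeZero k] (s : ZMod k → ZMod k) : ∑ c, zeroSum s c = 0 := by
  simp [zeroSum, Finset.sum_sub_distrib]

lemma eq_of_natCast_add_eq {k : ℕ} {t j j' : ℕ} (hj : j < k) (hj' : j' < k)
    (h : ((t + j : ℕ) : ZMod k) = ((t + j' : ℕ) : ZMod k)) : j = j' := by
  push_cast at h
  have := (ZMod.natCast_eq_natCast_iff' j j' k).1 (add_left_cancel h)
  rwa [Nat.mod_eq_of_lt hj, Nat.mod_eq_of_lt hj'] at this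

/-- The word of a `k`-set of parts, enumerated by `f`, and initial residues `s`: the parts recur
cyclically, and the starting phase is the sum of the residues. -/
def partWord {k : ℕ} [NeZero k] {γ δ : Type*} (x : ℕ → δ) (f : ZMod k → γ)
    (s : ZMod k → ZMod k) (i : ℕ) : γ × ZMod k × δ :=
  (f ((∑ c, s c).val + i : ℕ), residueSeq (zeroSum s) ((∑ c, s c).val + i), x i)

lemma partWord_ne {k : ℕ} [NeZero k] {γ δ : Type*} (x : ℕ → δ) {f : ZMod k → γ}
    (hf : Function.Injective f) (s : ZMod k → ZMod k) (i d : ℕ) (hd : 0 < d) (hdk : d < k) :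
    partWord x f s i ≠ partWord x f s (i + d) := by
  intro h
  have h1 := hf (congrArg Prod.fst h)
  rw [← add_assoc] at h1
  have := eq_of_natCast_add_eq (j := 0) (by omega) hdk h1
  omega

/-- The residue sum gives the phase plus position modulo `k`, which aligns the two blocks entry by
entry. The `x` coordinates then give the position, hence the phase `∑ c, s c`; the residues give
`zeroSum s`, and the two together recover `s`. -/
lemma partWord_window_inj {k : ℕ} [NeZero k] {γ δ : Type*} {x : ℕ → δ} {N : ℕ}
    (hx : ∀ i < N, ∀ i' < N, (∀ j < k, x (i + j) = x (i' + j)) → i = i')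
    {f : ZMod k → γ} (hf : Function.Injective f) {s s' : ZMod k → ZMod k} {i i' : ℕ}
    (hi : i < N) (hi' : i' < N)
    (h : ∀ b, (∃ j < k, partWord x f s (i + j) = b) ↔ ∃ j < k, partWord x f s' (i' + j) = b) :
    s = s' ∧ i = i' := by
  classical
  have hsum : ∀ (s : ZMod k → ZMod k) (i : ℕ),
      ∑ b ∈ (Finset.range k).image (fun j => partWord x f s (i + j)), b.2.1
        = (((∑ c, s c).val + i : ℕ) : ZMod k) := by
    intro s i
    rw [Finset.sum_image, ← sum_residueSeq _ (sum_zeroSum s)]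
    · exact Finset.sum_congr rfl fun j _ => by simp only [partWord, add_assoc]
    · intro j hj j' hj' he
      have h1 := hf (congrArg Prod.fst he)
      rw [← add_assoc, ← add_assoc] at h1
      exact eq_of_natCast_add_eq (by simpa using hj) (by simpa using hj') h1
  have himage : (Finset.range k).image (fun j => partWord x f s (i + j))
      = (Finset.range k).image (fun j => partWord x f s' (i' + j)) := by
    ext b; simpa using h b
  have hphase : (((∑ c, s c).val + i : ℕ) : ZMod k) = (((∑ c, s' c).val + i' : ℕ) : ZMod k) := by
    rw [← hsum, himage, hsum]
  have heq : ∀ j < k, partWord x f s (i + j) = partWord x f s' (i' + j) := by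
    intro j hj
    obtain ⟨j', hj', he⟩ := (h _).1 ⟨j, hj, rfl⟩
    have h1 := hf (congrArg Prod.fst he)
    rw [← add_assoc, ← add_assoc, Nat.cast_add, ← hphase, ← Nat.cast_add] at h1
    rw [eq_of_natCast_add_eq hj' hj h1] at he
    exact he.symm
  have hii : i = i' := hx i hi i' hi' fun j hj => congrArg (fun b => b.2.2) (heq j hj)
  subst hii
  have hb : ∑ c, s c = ∑ c, s' c := by
    push_cast at hphase
    simpa using hphase
  refine ⟨?_, rfl⟩
  have hz : ∀ c, zeroSum s c = zeroSum s' c := by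
    intro c
    set t := (∑ c, s c).val + i with ht
    set j := (c - (t : ZMod k)).val with hj
    have hc : ((t + j : ℕ) : ZMod k) = c := by simp [hj]
    have := congrArg (fun b => b.2.1) (heq j (ZMod.val_lt _))
    simp only [partWord, ← hb, ← add_assoc, ← ht, residueSeq, hc] at this
    exact add_right_cancel this
  have hfun : zeroSum s = zeroSum s' := funext hz
  simpa [zeroSum, hb] using hfun

lemma exists_packing_of_prime {k p M n : ℕ} (hk : 0 < k) (hp : p.Prime)
    (hn : M * k * p + M.choose k * k ^ k * k ≤ n) :
    ∃ L, ∃ s : Fin L → Fin n, IsUcyclePacking k s ∧ M.choose k * k ^ k * (p ^ k - 1) ≤ L := by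
  classical
  have : NeZero k := ⟨hk.ne'⟩
  have : Fact p.Prime := ⟨hp⟩
  obtain ⟨x, hx⟩ := exists_seq_windows_injective p k hk
  let T := {A : Finset (Fin M) // A ∈ Finset.powersetCard k Finset.univ}
  have henum : ∀ A : T, ∃ f : ZMod k → Fin M, Function.Injective f ∧ ∀ a, a ∈ A.1 ↔ ∃ c, f c = a := by
    intro A
    have hA : A.1.card = k := (Finset.mem_powersetCard.1 A.2).2
    let e : ZMod k ≃ A.1 := Fintype.equivOfCardEq (by simp [hA, ZMod.card])
    refine ⟨fun c => (e c).1, Subtype.val_injective.comp e.injective, fun a => ⟨fun ha => ?_, ?_⟩⟩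
    · exact ⟨e.symm ⟨a, ha⟩, by simp⟩
    · rintro ⟨c, rfl⟩
      exact (e c).2
  choose f hf hfA using henum
  have hcard : Fintype.card (T × (ZMod k → ZMod k)) = M.choose k * k ^ k := by
    simp [T, ZMod.card]
  let e : Fin (M.choose k * k ^ k) ≃ T × (ZMod k → ZMod k) :=
    (Fintype.equivFinOfCardEq hcard).symm
  have hpk : 0 < p ^ k - 1 := by
    have := Nat.one_lt_pow hk.ne' hp.one_lt
    omega
  refine exists_packing_of_words hk hpk ?_ (fun w => partWord x (f (e w).1) (e w).2)
    (fun w o d => partWord_ne x (hf _) _ o d) ?_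
  · simpa [ZMod.card, ← mul_assoc] using hn
  · intro w w' o ho o' ho' h
    have hsub : ∀ (A : T) (s : ZMod k → ZMod k) (i : ℕ) (a : Fin M),
        a ∈ A.1 ↔ ∃ b, (∃ j < k, partWord x (f A) s (i + j) = b) ∧ b.1 = a := by
      intro A s i a
      rw [hfA]
      constructor
      · rintro ⟨c, rfl⟩
        refine ⟨_, ⟨(c - (((∑ c, s c).val + i : ℕ) : ZMod k)).val, ZMod.val_lt _, rfl⟩, ?_⟩
        simp only [partWord, Nat.cast_add, ZMod.natCast_val, ZMod.cast_id]
        congr 1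
        ring
      · rintro ⟨_, ⟨j, _, rfl⟩, rfl⟩
        exact ⟨_, rfl⟩
    have hA : (e w).1 = (e w').1 := by
      refine Subtype.ext (Finset.ext fun a => ?_)
      rw [hsub _ (e w).2 o, hsub _ (e w').2 o']
      simp only [h]
    rw [← hA] at h
    obtain ⟨h1, h2⟩ := partWord_window_inj hx (hf _) ho ho' h
    exact ⟨e.injective (Prod.ext hA h1), h2⟩

/-! ### Counting and asymptotics -/

lemma IsUcyclePacking.ncard_coveredSubsets {n L k : ℕ} {s : Fin L → Fin n}
    (hs : IsUcyclePacking k s) : (coveredSubsets k s).ncard = L := by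
  have h : coveredSubsets k s = Set.range (windowSet k s) := by
    ext A
    constructor
    · rintro ⟨i, -, hi⟩
      exact ⟨i, hi⟩
    · rintro ⟨i, rfl⟩
      obtain ⟨A, hA, hi⟩ := hs.1 i
      exact ⟨i, hi ▸ hA, rfl⟩
  have hinj : Function.Injective (windowSet k s) := by
    intro i j hij
    obtain ⟨A, hA, hi⟩ := hs.1 i
    exact hs.2 A i j ⟨hA, hi⟩ ⟨hA, hij ▸ hi⟩
  rw [h, Set.ncard_eq_toFinset_card', Set.toFinset_range, Finset.card_image_of_injective _ hinj]
  simp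

lemma IsUcyclePacking.length_le {n L k : ℕ} {s : Fin L → Fin n}
    (hs : IsUcyclePacking k s) : L ≤ n.choose k := by
  rw [← hs.ncard_coveredSubsets]
  have h : coveredSubsets k s ⊆ (Finset.powersetCard k (Finset.univ : Finset (Fin n)) : Set _) := by
    rintro A ⟨i, hA, -⟩
    simpa using hA
  simpa [Set.ncard_coe_finset] using Set.ncard_le_ncard h

/-- Compare `n.choose k` with `n ^ k / k!` from above and `M.choose k` with `(M + 1 - k) ^ k / k!`
from below. Bernoulli's inequality loses `2 * k * δ`, and the missing `1` in `p ^ k - 1` loses one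
more `δ`. -/
lemma one_sub_mul_choose_le {δ : ℝ} (hδ : 0 < δ) {k p M n : ℕ} (hk : 0 < k)
    (hδ1 : 2 * δ ≤ 1) (hp : 1 ≤ δ * p)
    (hM : (1 - 2 * δ) * n ≤ ((M + 1 - k : ℕ) : ℝ) * (k * p)) :
    (1 - (2 * k + 1) * δ) * n.choose k ≤ ((M.choose k * k ^ k * (p ^ k - 1) : ℕ) : ℝ) := by
  have hp0 : 0 < (p : ℝ) := by
    by_contra h
    have : δ * p ≤ 0 := mul_nonpos_of_nonneg_of_nonpos hδ.le (not_lt.1 h)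
    linarith
  have hp1 : 1 ≤ p := by exact_mod_cast hp0
  have hδp : 1 ≤ δ * (p : ℝ) ^ k := by
    refine hp.trans (mul_le_mul_of_nonneg_left ?_ hδ.le)
    exact le_self_pow₀ (by exact_mod_cast hp1) hk.ne'
  have hfac : (0 : ℝ) < k.factorial := by exact_mod_cast k.factorial_pos
  have hup : (n.choose k : ℝ) * k.factorial ≤ (n : ℝ) ^ k := by
    have := Nat.descFactorial_le_pow n k
    rw [Nat.descFactorial_eq_factorial_mul_choose, mul_comm] at this
    exact_mod_cast this
  have hlow : ((M + 1 - k : ℕ) : ℝ) ^ k ≤ (M.choose k : ℝ) * k.factorial := by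
    have := Nat.pow_sub_le_descFactorial M k
    rw [Nat.descFactorial_eq_factorial_mul_choose, mul_comm k.factorial] at this
    exact_mod_cast this
  have hbern : 1 - 2 * k * δ ≤ (1 - 2 * δ) ^ k := by
    have := one_add_mul_le_pow (a := -(2 * δ)) (by linarith) k
    rw [← sub_eq_add_neg] at this
    linarith
  rcases le_or_gt (1 - (2 * k + 1) * δ) 0 with hneg | hpos
  · exact (mul_nonpos_of_nonpos_of_nonneg hneg (by positivity)).trans (by positivity)
  refine le_of_mul_le_mul_right ?_ hfac
  have hcoef : 1 - (2 * k + 1) * δ ≤ (1 - 2 * δ) ^ k * (1 - δ) := by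
    have h1 : 1 - (2 * k + 1) * δ ≤ (1 - 2 * k * δ) * (1 - δ) := by
      have : 0 ≤ 2 * (k : ℝ) * δ * δ := by positivity
      linarith
    exact h1.trans (mul_le_mul_of_nonneg_right hbern (by linarith))
  have hpow : (1 - 2 * δ) ^ k * (n : ℝ) ^ k
      ≤ ((M + 1 - k : ℕ) : ℝ) ^ k * ((k : ℝ) ^ k * (p : ℝ) ^ k) := by
    rw [← mul_pow, ← mul_pow, ← mul_pow]
    exact pow_le_pow_left₀ (mul_nonneg (by linarith) (by positivity)) hM k
  calc (1 - (2 * k + 1) * δ) * n.choose k * k.factorial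
      ≤ ((1 - 2 * δ) ^ k * (1 - δ)) * (n : ℝ) ^ k := by
        rw [mul_assoc]
        exact mul_le_mul hcoef hup (by positivity) (hpos.le.trans hcoef)
    _ = (1 - 2 * δ) ^ k * (n : ℝ) ^ k * (1 - δ) := by ring
    _ ≤ ((M + 1 - k : ℕ) : ℝ) ^ k * ((k : ℝ) ^ k * (p : ℝ) ^ k) * (1 - δ) :=
        mul_le_mul_of_nonneg_right hpow (by linarith)
    _ = ((M + 1 - k : ℕ) : ℝ) ^ k * ((k : ℝ) ^ k * ((p : ℝ) ^ k - δ * (p : ℝ) ^ k)) := by ring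
    _ ≤ (M.choose k : ℝ) * k.factorial * ((k : ℝ) ^ k * ((p : ℝ) ^ k - 1)) := by
        have h1 : 0 ≤ (p : ℝ) ^ k - δ * (p : ℝ) ^ k := by
          have : 0 ≤ (1 - δ) * (p : ℝ) ^ k := mul_nonneg (by linarith) (by positivity)
          linarith
        gcongr
    _ = _ := by
        push_cast [Nat.one_le_pow k p hp1]
        ring

lemma eventually_exists_packing_of_pos (k : ℕ) (hk : 0 < k) (ε : ℝ) (hε : 0 < ε) :
    ∀ᶠ n : ℕ in atTop, ∃ L, ∃ s : Fin L → Fin n,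
      IsUcyclePacking k s ∧ (1 - ε) * n.choose k ≤ L := by
  obtain ⟨δ, hδ, hδ1, hδε⟩ : ∃ δ : ℝ, 0 < δ ∧ 2 * δ ≤ 1 ∧ (2 * k + 1) * δ ≤ ε := by
    refine ⟨min (1 / 2) (ε / (2 * k + 1)), by positivity, ?_, ?_⟩
    · linarith [min_le_left (1 / 2) (ε / (2 * k + 1))]
    · have := min_le_right (1 / 2) (ε / (2 * k + 1))
      rw [le_div_iff₀ (by positivity)] at this
      linarith
  -- With `k * p * a ≤ n`, this makes `k` whole parts take up at most `δ * n` symbols.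
  obtain ⟨a, ha⟩ := exists_nat_gt (k / δ)
  have ha' : (k : ℝ) < δ * a := by
    rw [div_lt_iff₀ hδ] at ha
    linarith
  have ha0 : 0 < a := by
    rcases Nat.eq_zero_or_pos a with rfl | h
    · have : (0 : ℝ) ≤ k := by positivity
      simp only [Nat.cast_zero, mul_zero] at ha'
      linarith
    · exact h
  -- Bounds the number of fresh letters for every `M ≤ 2 * a`.
  set R : ℕ := (2 * a) ^ k * k ^ k * k with hR
  have hDpos : 0 < 2 * k * a := by positivity
  filter_upwards [eventually_ge_atTop (2 * k * a), eventually_ge_atTop R,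
    eventually_ge_atTop (2 * k * a * ⌈1 / δ⌉₊), eventually_ge_atTop ⌈R / δ⌉₊]
    with n hn1 hn2 hn3 hn4
  -- Bertrand's postulate fixes `p` up to a factor of two, so `M` stays at most `2 * a` while `p`
  -- grows with `n`.
  obtain ⟨p, hp, hxp, hpx⟩ := Nat.exists_prime_lt_and_le_two_mul (n / (2 * k * a))
    (Nat.div_pos hn1 hDpos).ne'
  have hkp : 0 < k * p := Nat.mul_pos hk hp.pos
  have hlow : n < 2 * k * a * p := by
    rw [mul_comm]
    exact (Nat.div_lt_iff_lt_mul hDpos).1 hxp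
  have hup : k * p * a ≤ n := by
    calc k * p * a ≤ k * (2 * (n / (2 * k * a))) * a := by gcongr
      _ = 2 * k * a * (n / (2 * k * a)) := by ring
      _ ≤ n := Nat.mul_div_le _ _
  set M := (n - R) / (k * p) with hM
  have hM1 : k * p * M ≤ n - R := Nat.mul_div_le _ _
  have hM2 : n - R < k * p * (M + 1) := Nat.lt_mul_div_succ _ hkp
  have hMa : M ≤ 2 * a := by
    refine le_of_lt (lt_of_mul_lt_mul_left (a := k * p) ?_ (Nat.zero_le _))
    calc k * p * M ≤ n := hM1.trans (Nat.sub_le _ _)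
      _ < k * p * (2 * a) := by rw [show k * p * (2 * a) = 2 * k * a * p by ring]; exact hlow
  have hcount : M * k * p + M.choose k * k ^ k * k ≤ n := by
    have h1 : M.choose k * k ^ k * k ≤ R := by
      rw [hR]
      gcongr
      exact (Nat.choose_le_pow M k).trans (Nat.pow_le_pow_left hMa k)
    have h2 : M * k * p = k * p * M := by ring
    omega
  obtain ⟨L, s, hs, hL⟩ := exists_packing_of_prime hk hp hcount
  refine ⟨L, s, hs, ?_⟩
  have hpδ : 1 ≤ δ * p := by
    have h1 : ⌈1 / δ⌉₊ ≤ p := by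
      refine le_of_lt (lt_of_mul_lt_mul_left (a := 2 * k * a) ?_ (Nat.zero_le _))
      exact hn3.trans_lt hlow
    have h2 := Nat.ceil_le.1 h1
    rw [div_le_iff₀ hδ] at h2
    linarith
  have hRδ : (R : ℝ) ≤ δ * n := by
    have h2 := Nat.ceil_le.1 hn4
    rw [div_le_iff₀ hδ] at h2
    linarith
  -- One `δ` pays for the `R` reserved symbols, the other for the `k` parts lost in `M + 1 - k`.
  have hMn : (1 - 2 * δ) * n ≤ ((M + 1 - k : ℕ) : ℝ) * (k * p) := by
    have h1 : (M : ℝ) + 1 - k ≤ ((M + 1 - k : ℕ) : ℝ) := by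
      have : M + 1 ≤ (M + 1 - k) + k := by omega
      have : ((M + 1 : ℕ) : ℝ) ≤ ((M + 1 - k + k : ℕ) : ℝ) := by exact_mod_cast this
      push_cast at this
      linarith
    have h2 : (n : ℝ) - R ≤ k * p * (M + 1) := by
      have : n ≤ k * p * (M + 1) + R := by omega
      have : (n : ℝ) ≤ ((k * p * (M + 1) + R : ℕ) : ℝ) := by exact_mod_cast this
      push_cast at this
      linarith
    have h3 : (k : ℝ) * (k * p) ≤ δ * n := by
      have h4 : (k : ℝ) * p * a ≤ n := by exact_mod_cast hup
      calc (k : ℝ) * (k * p) ≤ δ * a * (k * p) := by gcongr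
        _ = δ * (k * p * a) := by ring
        _ ≤ δ * n := by gcongr
    have h5 := mul_le_mul_of_nonneg_right h1 (show (0 : ℝ) ≤ k * p by positivity)
    linarith
  have hmain := one_sub_mul_choose_le hδ hk hδ1 hpδ hMn
  have hLr : ((M.choose k * k ^ k * (p ^ k - 1) : ℕ) : ℝ) ≤ L := by exact_mod_cast hL
  refine le_trans ?_ (hmain.trans hLr)
  gcongr

/-- For `k = 0` every block is empty, so one position already covers everything; it still needs a
symbol to hold. -/
lemma exists_packing_zero {n : ℕ} (hn : 0 < n) :
    ∃ s : Fin 1 → Fin n, IsUcyclePacking 0 s :=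
  ⟨fun _ => ⟨0, hn⟩, fun _ => ⟨∅, rfl, rfl⟩, fun _ _ _ _ _ => Subsingleton.elim _ _⟩

lemma eventually_exists_packing (k : ℕ) (ε : ℝ) (hε : 0 < ε) :
    ∀ᶠ n : ℕ in atTop, ∃ L, ∃ s : Fin L → Fin n,
      IsUcyclePacking k s ∧ (1 - ε) * n.choose k ≤ L := by
  rcases Nat.eq_zero_or_pos k with rfl | hk
  · filter_upwards [eventually_gt_atTop 0] with n hn
    obtain ⟨s, hs⟩ := exists_packing_zero hn
    exact ⟨1, s, hs, by simp [hε.le]⟩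
  · exact eventually_exists_packing_of_pos k hk ε hε

/-- Longest packings merge the constructions for different `ε` into one family. -/
lemma exists_longest_packing (k n : ℕ) :
    ∃ L, ∃ s : Fin L → Fin n, IsUcyclePacking k s ∧
      ∀ L', ∀ s' : Fin L' → Fin n, IsUcyclePacking k s' → L' ≤ L := by
  classical
  have h0 : ∃ s : Fin 0 → Fin n, IsUcyclePacking k s :=
    ⟨Fin.elim0, fun i => i.elim0, fun _ i => i.elim0⟩
  obtain ⟨s, hs⟩ := Nat.findGreatest_spec (P := fun L => ∃ s : Fin L → Fin n, IsUcyclePacking k s)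
    (Nat.zero_le (n.choose k)) h0
  exact ⟨_, s, hs, fun L' s' hs' => Nat.le_findGreatest hs'.length_le ⟨s', hs'⟩⟩

theorem theorem4 (k : ℕ) :
    ∃ (L : ℕ → ℕ) (S : ∀ n : ℕ, Fin (L n) → Fin n),
      IsNearUcycle k L S ∧
      Tendsto (fun n : ℕ => ((coveredSubsets k (S n)).ncard : ℝ) / (n.choose k : ℝ))
        atTop (𝓝 1) := by
  choose L S hS hmax using exists_longest_packing k
  have hlim : Tendsto (fun n : ℕ => (L n : ℝ) / (n.choose k : ℝ)) atTop (𝓝 1) := by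
    refine tendsto_order.2 ⟨fun a ha => ?_, fun a ha => Eventually.of_forall fun n => ?_⟩
    · filter_upwards [eventually_exists_packing k ((1 - a) / 2) (by linarith),
        eventually_ge_atTop k] with n ⟨L', s, hs, hL'⟩ hn
      have hpos : (0 : ℝ) < n.choose k := by exact_mod_cast Nat.choose_pos hn
      rw [lt_div_iff₀ hpos]
      have hle : (L' : ℝ) ≤ L n := by exact_mod_cast hmax n L' s hs
      have := mul_lt_mul_of_pos_right (show a < 1 - (1 - a) / 2 by linarith) hpos
      linarith
    · refine (div_le_one_of_le₀ ?_ (by positivity)).trans_lt ha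
      exact_mod_cast (hS n).length_le
  refine ⟨L, S, ⟨hS, fun n => 1 - (L n : ℝ) / (n.choose k : ℝ), ?_, fun n => ?_⟩, ?_⟩
  · simpa using hlim.const_sub 1
  · rw [sub_sub_cancel]
    -- If `n < k`, the quotient is `0` by convention, and the length vanishes as well.
    rcases eq_or_ne (n.choose k) 0 with h0 | h0
    · have := (hS n).length_le
      have hL : L n = 0 := by omega
      simp [hL]
    · rw [div_mul_cancel₀ _ (by exact_mod_cast h0)]
  · simpa only [(hS _).ncard_coveredSubsets] using hlim
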